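/- Let $G$ be a compact topological group and let $Y$ be a metrizable $G$-space, i.e. a metrizable space with a continuous action $G\times Y\to Y$. Let $X\subset Y$ be a compact $G$-invariant subset with more than one point. For a $G$-space $Z$ let $C_{inv}(Z\times Z)$ be the linear space, with the compact-open topology, of all continuous functions $f:Z\times Z\to\mathbb R$ such that $f(gx,gy)=f(x,y)$ for all $g\in G$ and $x,y\in Z$, and put $\|f\|=\sup_{Z\times Z}|f|\in[0,\infty]$. Call a metric $p$ on $Z$ admissible if $p:Z\times Z\to\mathbb R$ is continuous and for every $x\in Z$ and every open neighborhood $U$ of $x$ there is $\delta>0$ with $\{y\in Z: p(x,y)<\delta\}\subset U$ (that is, $p$ generates the topology of $Z$). Then for every $\varepsilon>0$ there is a linear operator $T:C_{inv}(X\times X)\to C_{inv}(Y\times Y)$ such that: 1. $T$ is positive ($p\ge 0$ implies $T(p)\ge 0$) and continuous (for the compact-open topologies); 2. $T$ is an extension operator: $T(p)|_{X\times X}=p$ for every $p\in C_{inv}(X\times X)$; 3. $\|T\|=\inf\{M\ge 0: \|T(p)\|\le M\|p\| \text{ for all } p\in C_{inv}(X\times X)\}<1+\varepsilon$; 4. if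 $p\in C_{inv}(X\times X)$ is a pseudometric on $X$, then $T(p)$ is a pseudometric on $Y$; if $p$ is a metric on $X$, then $T(p)$ is a metric on $Y$; if $p$ is an admissible metric on $X$, then $T(p)$ is an admissible metric on $Y$; 5. if $G$ is finite, then $T$ is also continuous with respect to the topologies of pointwise convergence on $C_{inv}(X\times X)$ and $C_{inv}(Y\times Y)$. -/

import Mathlib

open scoped ENNReal NNReal Topology

namespace InvMetric

/-- The linear space of continuous functions `f : Z × Z → ℝ` on the square of a `G`-space `Z`
which are invariant: `f (g x, g y) = f (x, y)`. As a subspace of `C(Z × Z, ℝ)` it carries the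
compact-open topology. -/
def CInv (G Z : Type*) [TopologicalSpace Z] [SMul G Z] : Submodule ℝ C(Z × Z, ℝ) where
  carrier := {f | ∀ (g : G) (x y : Z), f (g • x, g • y) = f (x, y)}
  zero_mem' := fun _ _ _ => rfl
  add_mem' := fun {a b} ha hb g x y => by
    simp only [ContinuousMap.add_apply, ha g x y, hb g x y]
  smul_mem' := fun c a ha g x y => by
    simp only [ContinuousMap.smul_apply, ha g x y]

/-- The topology of pointwise convergence on `CInv G Z`. -/
abbrev pointwiseTopology (G Z : Type*) [TopologicalSpace Z] [SMul G Z] :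
    TopologicalSpace (CInv G Z) :=
  TopologicalSpace.induced (fun f : CInv G Z => fun z : Z × Z => f.1 z) Pi.topologicalSpace

/-- The sup-norm `sup |f| ∈ [0, ∞]` of a real function. -/
noncomputable def supNorm {Z : Type*} (f : Z → ℝ) : ℝ≥0∞ := ⨆ z, ‖f z‖ₑ

/-- The norm `inf {M | ∀ f, ‖T f‖ ≤ M ‖f‖} ∈ [0, ∞]` of a linear operator, with respect to the
sup-norms (it is `∞` if there is no such finite `M`). -/
noncomputable def opNorm {G Z W : Type*} [TopologicalSpace Z] [SMul G Z]
    [TopologicalSpace W] [SMul G W] (T : CInv G Z →ₗ[ℝ] CInv G W) : ℝ≥0∞ :=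
  ⨅ (M : ℝ≥0) (_ : ∀ f : CInv G Z, supNorm (T f).1 ≤ (M : ℝ≥0∞) * supNorm f.1), (M : ℝ≥0∞)

/-- `p` is a pseudometric on the set `Z`. -/
structure IsPseudometric {Z : Type*} (p : Z × Z → ℝ) : Prop where
  nonneg : ∀ x y, 0 ≤ p (x, y)
  self : ∀ x, p (x, x) = 0
  symm : ∀ x y, p (x, y) = p (y, x)
  triangle : ∀ x y z, p (x, z) ≤ p (x, y) + p (y, z)

/-- `p` is a metric on the set `Z`. -/
structure IsMetric {Z : Type*} (p : Z × Z → ℝ) : Prop extends IsPseudometric p where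
  eq_of_eq_zero : ∀ x y, p (x, y) = 0 → x = y

/-- `p` is an admissible metric on the topological space `Z`: a continuous metric such that
every open neighborhood of a point contains a `p`-ball centered at this point; equivalently, a
metric which generates the topology of `Z`. -/
structure IsAdmissibleMetric {Z : Type*} [TopologicalSpace Z] (p : Z × Z → ℝ) : Prop
    extends IsMetric p where
  continuous : Continuous p
  dominating : ∀ (x : Z) (U : Set Z), IsOpen U → x ∈ U → ∃ ε > 0, {y | p (x, y) < ε} ⊆ U

end InvMetric

namespace InvMetric

open MeasureTheory Set Filter

/-! Fix an invariant compatible metric on `Y`. The operator is `T p = P (S p) + ε * p (a, b) * d`.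

`S` is a random retraction: for `t ∈ [0, 1]`, `nearSelect` sends `y` to a point `ξ_t y` of `X`,
nearest up to the factor `2 + t` and equal to `y` when `y ∈ X`. Put `S f (y, y') = ∫ f (ξ_t y, ξ_t
y') dt`. Each `ξ_t` may jump, but a given `y` is a jump point only for a null set of `t`, so the
integral is continuous. Using the same `t` in both coordinates makes `S f` an average of pullbacks
of `f`, which keeps pseudometrics (`exists_linear_extension`).

`P` averages over `G`; it leaves the values on `X` alone because `p` is already invariant
(`exists_averaging`).

`P (S p)` need not separate points off `X`. The pseudometric `d = collapseDist X` does so, while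
being invariant, bounded by `1` and zero on `X × X`; hence the extra term costs only `ε` in norm.
For a metric `p` and distinct `a, b ∈ X` its coefficient is positive, and compactness of `X` then
makes `T p` admissible (`isAdmissibleMetric_of_collapseDist_le`). -/

/-! ### Invariant means and invariant metrics. -/

/-- A compact group has a right-invariant mean on its continuous functions; for a finite group it
can be taken to be a finite linear combination of evaluations. -/
theorem exists_rightInvariant_mean (G : Type*) [Group G] [TopologicalSpace G]
    [IsTopologicalGroup G] [CompactSpace G] :
    ∃ A : C(G, ℝ) →ₗ[ℝ] ℝ, (∀ f : C(G, ℝ), (∀ g, 0 ≤ f g) → 0 ≤ A f) ∧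
      (∀ c : ℝ, A (ContinuousMap.const G c) = c) ∧
      (∀ (f : C(G, ℝ)) (h : G), A (f.comp (ContinuousMap.mulRight h)) = A f) ∧
      (Finite G → ∃ (s : Finset G) (c : ℝ), ∀ f : C(G, ℝ), A f = c * ∑ g ∈ s, f g) := by
  by_cases hG : Finite G
  · have := Fintype.ofFinite G
    have hcard : (Fintype.card G : ℝ) ≠ 0 := by exact_mod_cast Fintype.card_ne_zero
    refine ⟨{ toFun := fun f => (Fintype.card G : ℝ)⁻¹ * ∑ g, f g
              map_add' := fun f f' => by simp [Finset.sum_add_distrib, mul_add]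
              map_smul' := fun c f => by simp [← Finset.mul_sum, mul_left_comm] },
      fun f hf => ?_, fun c => ?_, fun f h => ?_, fun _ => ⟨Finset.univ, _, fun f => rfl⟩⟩
    · exact mul_nonneg (by positivity) (Finset.sum_nonneg fun g _ => hf g)
    · simp [hcard]
    · simp only [LinearMap.coe_mk, AddHom.coe_mk, ContinuousMap.comp_apply,
        ContinuousMap.coe_mulRight]
      exact congrArg _ (Equiv.sum_comp (Equiv.mulRight h) fun g => f g)
  · borelize G
    -- Haar measure is left-invariant; inversion makes it right-invariant. It is not normalised,
    -- hence the division by the total mass below.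
    let μ : Measure G := (Measure.haar : Measure G).inv
    have hint : ∀ f : C(G, ℝ), Integrable f μ := fun f => by
      obtain ⟨C, hC⟩ := (isCompact_range f.continuous).isBounded.exists_norm_le
      exact Integrable.of_bound f.continuous.measurable.aestronglyMeasurable C
        (Eventually.of_forall fun g => hC _ (mem_range_self g))
    have hμ : μ.real univ ≠ 0 := by
      have : NeZero μ := inferInstance
      exact measureReal_univ_ne_zero
    refine ⟨{ toFun := fun f => (μ.real univ)⁻¹ * ∫ g, f g ∂μ
              map_add' := fun f f' => by
                simp only [ContinuousMap.add_apply]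
                rw [integral_add (hint f) (hint f'), mul_add]
              map_smul' := fun c f => by
                simp only [ContinuousMap.smul_apply, smul_eq_mul, integral_const_mul, RingHom.id_apply]
                ring },
      fun f hf => ?_, fun c => ?_, fun f h => ?_, fun h => absurd h hG⟩
    · exact mul_nonneg (by positivity) (integral_nonneg hf)
    · simp [hμ]
    · simp only [LinearMap.coe_mk, AddHom.coe_mk, ContinuousMap.comp_apply,
        ContinuousMap.coe_mulRight]
      rw [integral_mul_right_eq_self (fun g => f g) h]

/-- A metrizable space with a continuous action of a compact group has an invariant compatible
metric. -/
theorem exists_metricSpace_isIsometricSMul (G Y : Type*) [Group G] [TopologicalSpace G]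
    [CompactSpace G] [t : TopologicalSpace Y] [TopologicalSpace.MetrizableSpace Y] [MulAction G Y]
    [ContinuousSMul G Y] :
    ∃ m : MetricSpace Y, t = m.toPseudoMetricSpace.toUniformSpace.toTopologicalSpace ∧
      IsIsometricSMul G Y := by
  let D : Y → Y → ℝ := letI := TopologicalSpace.metrizableSpaceMetric Y
    fun x y => ⨆ g : G, dist (g • x) (g • y)
  let m₀ := TopologicalSpace.metrizableSpaceMetric Y
  have hbdd : ∀ x y : Y, BddAbove (range fun g : G => dist (g • x) (g • y)) := fun x y =>
    (isCompact_range (by fun_prop)).bddAbove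
  have hle : ∀ (g : G) (x y : Y), dist (g • x) (g • y) ≤ D x y := fun g x y =>
    le_ciSup (hbdd x y) g
  have hle' : ∀ x y : Y, dist x y ≤ D x y := fun x y => by simpa using hle 1 x y
  have hself : ∀ x, D x x = 0 := fun x => by simp [D]
  -- A supremum over the compact `G` of a jointly continuous function is continuous. Together with
  -- `dist ≤ D` this shows that `D` generates the original topology.
  have hcont : Continuous fun z : Y × Y => D z.1 z.2 := by
    have := IsCompact.continuous_sSup (f := fun (z : Y × Y) (g : G) => dist (g • z.1) (g • z.2))
      isCompact_univ (by simp only [Function.HasUncurry.uncurry, id]; fun_prop)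
    simp only [image_univ] at this
    exact this
  let m : MetricSpace Y := MetricSpace.ofDistTopology D hself
    (fun x y => by simp only [D, dist_comm])
    (fun x y z => ciSup_le fun g => (dist_triangle _ (g • y) _).trans
      (add_le_add (hle g x y) (hle g y z)))
    (fun s => by
      constructor
      · intro hs x hx
        obtain ⟨δ, hδ, h⟩ := Metric.isOpen_iff.1 hs x hx
        exact ⟨δ, hδ, fun y hy => h (by rw [Metric.mem_ball']; exact (hle' x y).trans_lt hy)⟩
      · intro h
        refine isOpen_iff_mem_nhds.2 fun x hx => ?_
        obtain ⟨δ, hδ, hs⟩ := h x hx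
        have hc : Continuous fun y => D x y := hcont.comp (Continuous.prodMk_right x)
        have : ∀ᶠ y in 𝓝 x, D x y < δ :=
          hc.continuousAt.eventually_lt continuousAt_const (by simpa [hself] using hδ)
        exact mem_of_superset this hs)
    (fun x y h => dist_le_zero.1 ((hle' x y).trans h.le))
  refine ⟨m, rfl, ⟨fun h => ?_⟩⟩
  refine Isometry.of_dist_eq fun x y => ?_
  change ⨆ g : G, m₀.dist (g • h • x) (g • h • y) = ⨆ g : G, m₀.dist (g • x) (g • y)
  simp only [smul_smul]
  exact (Equiv.mulRight h).iSup_congr fun g => rfl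

/-! ### Random nearest-point selection and the linear extension. -/

section Selection

variable {X Y : Type*} [MetricSpace Y]

open Classical in
/-- A map `Y → X`, depending on a parameter `t`: on the image of `ι` it is the inverse of `ι`;
elsewhere it picks the first term of the sequence `u` which is nearest to `y` up to the
factor `2 + t`. -/
noncomputable def nearSelect (ι : X → Y) (u : ℕ → X) (y : Y) (t : ℝ) : X :=
  if h : y ∈ range ι then h.choose
  else u (sInf {n | dist y (ι (u n)) < (2 + t) * Metric.infDist y (range ι)})

variable {ι : X → Y} {u : ℕ → X}

theorem nearSelect_of_notMem {y : Y} (h : y ∉ range ι) (t : ℝ) : nearSelect ι u y t =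
    u (sInf {n | dist y (ι (u n)) < (2 + t) * Metric.infDist y (range ι)}) := dif_neg h

variable [MetricSpace X]

theorem nearSelect_apply (hι : Isometry ι) (x : X) (t : ℝ) : nearSelect ι u (ι x) t = x := by
  have h : ι x ∈ range ι := mem_range_self x
  rw [nearSelect, dif_pos h]
  exact hι.injective h.choose_spec

variable [CompactSpace X]

theorem infDist_range_pos (hι : Isometry ι) [Nonempty X] {y : Y} (h : y ∉ range ι) :
    0 < Metric.infDist y (range ι) :=
  ((isCompact_range hι.continuous).isClosed.notMem_iff_infDist_pos (range_nonempty ι)).1 h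

theorem exists_dist_lt_two_mul_infDist (hι : Isometry ι) (hu : DenseRange u) {y : Y} (h : y ∉ range ι) :
    ∃ n, dist y (ι (u n)) < 2 * Metric.infDist y (range ι) := by
  have : Nonempty X := ⟨u 0⟩
  have hpos := infDist_range_pos hι h
  obtain ⟨_, ⟨x, rfl⟩, hx⟩ := (Metric.infDist_lt_iff (range_nonempty ι)).1
    (show Metric.infDist y (range ι) < 2 * Metric.infDist y (range ι) by linarith)
  exact hu.exists_mem_open (s := {x | dist y (ι x) < 2 * Metric.infDist y (range ι)})
    (isOpen_lt (continuous_const.dist hι.continuous) continuous_const) ⟨x, hx⟩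

theorem nearIndex_nonempty (hι : Isometry ι) (hu : DenseRange u) {y : Y} (h : y ∉ range ι) {t : ℝ} (ht : 0 ≤ t) :
    {n | dist y (ι (u n)) < (2 + t) * Metric.infDist y (range ι)}.Nonempty := by
  obtain ⟨n, hn⟩ := exists_dist_lt_two_mul_infDist hι hu h
  refine ⟨n, hn.trans_le ?_⟩
  gcongr
  · exact Metric.infDist_nonneg
  · linarith

theorem dist_nearSelect_le (hι : Isometry ι) (hu : DenseRange u) (y : Y) {t : ℝ} (ht : 0 ≤ t) :
    dist y (ι (nearSelect ι u y t)) ≤ (2 + t) * Metric.infDist y (range ι) := by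
  by_cases h : y ∈ range ι
  · obtain ⟨x, rfl⟩ := h
    rw [nearSelect_apply hι, dist_self]
    exact mul_nonneg (by linarith) Metric.infDist_nonneg
  · rw [nearSelect_of_notMem h]
    have := Nat.sInf_mem (nearIndex_nonempty hι hu h ht)
    exact (mem_ofPred.1 this).le

/-- The selected index is locally constant: the strict inequality at the first index `N` persists
near `y`, and `hne` makes its failure at each `n < N` strict, so that it persists too. -/
theorem continuousAt_nearSelect_of_notMem (hι : Isometry ι) (hu : DenseRange u) {y : Y} (h : y ∉ range ι) {t : ℝ}
    (ht : 0 ≤ t)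
    (hne : ∀ n, dist y (ι (u n)) ≠ (2 + t) * Metric.infDist y (range ι)) :
    ContinuousAt (fun y' => nearSelect ι u y' t) y := by
  set N := sInf {n | dist y (ι (u n)) < (2 + t) * Metric.infDist y (range ι)} with hN
  have hNmem : dist y (ι (u N)) < (2 + t) * Metric.infDist y (range ι) :=
    Nat.sInf_mem (nearIndex_nonempty hι hu h ht)
  have hcd : ∀ n, Continuous fun y' : Y => dist y' (ι (u n)) := fun n => by fun_prop
  have hci : Continuous fun y' : Y => (2 + t) * Metric.infDist y' (range ι) :=
    continuous_const.mul (Metric.continuous_infDist_pt _)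
  have h1 : ∀ᶠ y' in 𝓝 y, dist y' (ι (u N)) < (2 + t) * Metric.infDist y' (range ι) :=
    (hcd N).continuousAt.eventually_lt hci.continuousAt hNmem
  have h2 : ∀ᶠ y' in 𝓝 y, ∀ n ∈ Finset.range N,
      (2 + t) * Metric.infDist y' (range ι) < dist y' (ι (u n)) := by
    rw [Filter.eventually_all_finset]
    intro n hn
    refine hci.continuousAt.eventually_lt (hcd n).continuousAt ?_
    have := Nat.notMem_of_lt_sInf (Finset.mem_range.1 hn)
    exact lt_of_le_of_ne (not_lt.1 this) (hne n).symm
  have h3 : ∀ᶠ y' in 𝓝 y, y' ∉ range ι :=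
    (isCompact_range hι.continuous).isClosed.isOpen_compl.mem_nhds h
  refine (continuousAt_const (y := u N)).congr ?_
  filter_upwards [h1, h2, h3] with y' h1 h2 h3
  rw [nearSelect_of_notMem h3]
  congr 1
  refine le_antisymm ?_ (Nat.sInf_le h1)
  by_contra! hlt
  have hmem := Nat.sInf_mem (s := {n | dist y' (ι (u n)) < (2 + t) * Metric.infDist y' (range ι)})
    ⟨N, h1⟩
  exact (h2 _ (Finset.mem_range.2 hlt)).not_gt (mem_ofPred.1 hmem)

/-- The selected point lies within `(2 + t) * infDist` of `y'`, and this bound tends to `0` as `y'`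
approaches the image of `ι`. -/
theorem continuousAt_nearSelect_apply (hι : Isometry ι) (hu : DenseRange u) (x : X) {t : ℝ} (ht : 0 ≤ t) :
    ContinuousAt (fun y' => nearSelect ι u y' t) (ι x) := by
  have hlim : Tendsto (fun y' => dist y' (ι x) + (2 + t) * Metric.infDist y' (range ι))
      (𝓝 (ι x)) (𝓝 0) := by
    have hc : Continuous fun y' => dist y' (ι x) + (2 + t) * Metric.infDist y' (range ι) :=
      (continuous_id.dist continuous_const).add
        (continuous_const.mul (Metric.continuous_infDist_pt _))
    have := hc.tendsto (ι x)
    rwa [dist_self, Metric.infDist_zero_of_mem (mem_range_self x), mul_zero, add_zero] at this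
  rw [ContinuousAt, nearSelect_apply hι, tendsto_iff_dist_tendsto_zero]
  refine squeeze_zero (fun _ => dist_nonneg) (fun y' => ?_) hlim
  rw [← hι.dist_eq]
  have h1 := dist_nearSelect_le hι hu y' ht
  have h2 := dist_triangle_left (ι (nearSelect ι u y' t)) (ι x) y'
  linarith

theorem ae_continuousAt_nearSelect (hι : Isometry ι) (hu : DenseRange u) (y : Y) :
    ∀ᵐ t : unitInterval, ContinuousAt (fun y' => nearSelect ι u y' t) y := by
  by_cases h : y ∈ range ι
  · obtain ⟨x, rfl⟩ := h
    exact Eventually.of_forall fun t => continuousAt_nearSelect_apply hι hu x t.2.1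
  · have : Nonempty X := ⟨u 0⟩
    have hpos := infDist_range_pos hι h
    have hae : ∀ᵐ t : unitInterval, ∀ n,
        dist y (ι (u n)) ≠ (2 + (t : ℝ)) * Metric.infDist y (range ι) := by
      rw [ae_all_iff]
      intro n
      rw [ae_iff]
      -- For each `n` at most one `t` gives equality, because `infDist` is positive.
      refine Set.Subsingleton.measure_zero (fun s hs t ht => ?_) _
      simp only [ne_eq, not_not, mem_ofPred_eq] at hs ht
      have := mul_right_cancel₀ hpos.ne' (hs.symm.trans ht)
      exact Subtype.ext (by linarith)
    filter_upwards [hae] with t ht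
    exact continuousAt_nearSelect_of_notMem hι hu h t.2.1 ht

/-- For fixed `y` the map `nearSelect` is a simple function of the parameter. -/
noncomputable def nearSelectSimple (hι : Isometry ι) (hu : DenseRange u) (y : Y) :
    SimpleFunc unitInterval X where
  toFun t := nearSelect ι u y t
  finite_range' := by
    by_cases h : y ∈ range ι
    · obtain ⟨x, rfl⟩ := h
      simp_rw [nearSelect_apply hι]
      exact (finite_singleton x).subset (range_subset_iff.2 fun _ => rfl)
    -- An index that is good for the factor `2` is good for every `2 + t`, so it bounds the selected
    -- index uniformly in `t`.
    · obtain ⟨N, hN⟩ := exists_dist_lt_two_mul_infDist hι hu h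
      refine ((finite_Iic N).image u).subset (range_subset_iff.2 fun t => ?_)
      rw [nearSelect_of_notMem h]
      refine mem_image_of_mem _ (Nat.sInf_le (hN.trans_le ?_))
      gcongr
      · exact Metric.infDist_nonneg
      · linarith [t.2.1]
  measurableSet_fiber' v := by
    by_cases h : y ∈ range ι
    · obtain ⟨x, rfl⟩ := h
      simp_rw [nearSelect_apply hι]
      exact MeasurableSet.const (x = v)
    · simp_rw [nearSelect_of_notMem h]
      let s : unitInterval → ℕ := fun t =>
        sInf {n | dist y (ι (u n)) < (2 + (t : ℝ)) * Metric.infDist y (range ι)}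
      have hs : Measurable s := by
        refine measurable_of_Iic fun N => ?_
        have : s ⁻¹' Iic N = ⋃ n ∈ Iic N, {t : unitInterval |
            dist y (ι (u n)) < (2 + (t : ℝ)) * Metric.infDist y (range ι)} := by
          ext t
          simp only [mem_preimage, mem_Iic, mem_iUnion, exists_prop, mem_ofPred_eq]
          exact ⟨fun hle => ⟨s t, hle, Nat.sInf_mem (nearIndex_nonempty hι hu h t.2.1)⟩,
            fun ⟨n, hn, hlt⟩ => (Nat.sInf_le hlt).trans hn⟩
        rw [this]
        refine MeasurableSet.biUnion (to_countable _) fun n _ => IsOpen.measurableSet ?_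
        exact isOpen_lt continuous_const (by fun_prop)
      exact hs (MeasurableSet.of_discrete (s := u ⁻¹' {v}))

end Selection

/-- The weights do not depend on `f`, so the integral is a fixed finite combination of values of
`f`; pointwise continuity for finite `G` rests on this. -/
theorem integral_comp_simpleFunc {Ω V : Type*} [MeasurableSpace Ω] {μ : Measure Ω}
    [IsFiniteMeasure μ] (z : SimpleFunc Ω V) (f : V → ℝ) :
    ∫ t, f (z t) ∂μ = ∑ v ∈ z.range, μ.real (z ⁻¹' {v}) * f v := by
  classical
  have h : ∀ t, f (z t) = ∑ v ∈ z.range, (z ⁻¹' {v}).indicator (fun _ => f v) t := fun t => by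
    rw [Finset.sum_eq_single_of_mem (z t) (z.mem_range_self t)]
    · simp
    · intro v _ hv
      exact indicator_of_notMem (fun h => hv (by simpa using h.symm)) _
  simp_rw [h]
  rw [integral_finsetSum _ fun v _ => (integrable_const _).indicator (z.measurableSet_fiber v)]
  refine Finset.sum_congr rfl fun v _ => ?_
  rw [integral_indicator_const _ (z.measurableSet_fiber v), smul_eq_mul]

/-- Continuous functions on the square of a compact subspace `X` of a metric space `Y` extend to
the square of `Y` by a positive unital linear operator, which preserves pseudometrics and whose
values at a point are finite combinations of values. -/
theorem exists_linear_extension {X Y : Type*} [MetricSpace X] [CompactSpace X] [Nonempty X]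
    [MetricSpace Y] {ι : X → Y} (hι : Isometry ι) :
    ∃ S : C(X × X, ℝ) →ₗ[ℝ] C(Y × Y, ℝ),
      (∀ f : C(X × X, ℝ), (∀ z, 0 ≤ f z) → ∀ z, 0 ≤ S f z) ∧
      (∀ (f : C(X × X, ℝ)) (x x' : X), S f (ι x, ι x') = f (x, x')) ∧
      (∀ (f : C(X × X, ℝ)) z, ‖S f z‖ ≤ ‖f‖) ∧
      (∀ f : C(X × X, ℝ), IsPseudometric f → IsPseudometric (S f)) ∧
      (∀ z, ∃ (s : Finset (X × X)) (w : X × X → ℝ),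
        ∀ f : C(X × X, ℝ), S f z = ∑ v ∈ s, w v * f v) := by
  obtain ⟨u, hu⟩ := TopologicalSpace.exists_dense_seq X
  let ξ : Y → SimpleFunc unitInterval X := nearSelectSimple hι hu
  have hξι : ∀ x t, ξ (ι x) t = x := fun x t => nearSelect_apply hι x t
  have hint : ∀ (f : C(X × X, ℝ)) (y y' : Y),
      Integrable (fun t => f (ξ y t, ξ y' t)) (volume : Measure unitInterval) := fun f y y' =>
    (((ξ y).pair (ξ y')).map f).integrable_of_isFiniteMeasure
  have hcont : ∀ f : C(X × X, ℝ),
      Continuous fun z : Y × Y => ∫ t : unitInterval, f (ξ z.1 t, ξ z.2 t) := fun f => by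
    refine continuous_iff_continuousAt.2 fun z => ?_
    -- Dominated convergence: for almost every `t` both selections are continuous at the given
    -- points.
    refine continuousAt_of_dominated (bound := fun _ => ‖f‖)
      (Eventually.of_forall fun z' => (hint f z'.1 z'.2).aestronglyMeasurable)
      (Eventually.of_forall fun z' => Eventually.of_forall fun t => f.norm_coe_le_norm _)
      (integrable_const _) ?_
    filter_upwards [ae_continuousAt_nearSelect hι hu z.1, ae_continuousAt_nearSelect hι hu z.2]
      with t h1 h2
    exact f.continuous.continuousAt.comp
      ((h1.comp continuousAt_fst).prodMk (h2.comp continuousAt_snd))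
  refine ⟨{ toFun := fun f => ⟨_, hcont f⟩
            map_add' := fun f f' => ContinuousMap.ext fun z =>
              integral_add (hint f z.1 z.2) (hint f' z.1 z.2)
            map_smul' := fun c f => ContinuousMap.ext fun z => integral_const_mul c _ },
    fun f hf z => integral_nonneg fun t => hf _, fun f x x' => ?_, fun f z => ?_,
    fun f hf => ?_, fun z => ?_⟩
  · simp [hξι]
  · refine (norm_integral_le_of_norm_le_const
      (Eventually.of_forall fun t => f.norm_coe_le_norm _)).trans_eq ?_
    simp
  · refine ⟨fun x y => integral_nonneg fun t => hf.nonneg _ _, fun x => ?_, fun x y => ?_,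
      fun x y z => ?_⟩
    · simp [hf.self]
    · exact integral_congr_ae (Eventually.of_forall fun t => hf.symm _ _)
    · refine le_of_le_of_eq ?_ (integral_add (hint f x y) (hint f y z))
      exact integral_mono (hint f x z) ((hint f x y).add (hint f y z)) fun t =>
        hf.triangle _ _ _
  · exact ⟨_, _, fun f => integral_comp_simpleFunc ((ξ z.1).pair (ξ z.2)) f⟩

/-! ### Averaging over the group. -/

theorem mono_of_nonneg {G : Type*} [TopologicalSpace G] {A : C(G, ℝ) →ₗ[ℝ] ℝ}
    (hA : ∀ f : C(G, ℝ), (∀ g, 0 ≤ f g) → 0 ≤ A f) {f f' : C(G, ℝ)} (h : ∀ g, f g ≤ f' g) :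
    A f ≤ A f' := by
  have := hA (f' - f) fun g => by simpa using h g
  rwa [map_sub, sub_nonneg] at this

/-- A positive unital functional is bounded by any bound of the function. -/
theorem norm_le_of_nonneg {G : Type*} [TopologicalSpace G] {A : C(G, ℝ) →ₗ[ℝ] ℝ}
    (hA : ∀ f : C(G, ℝ), (∀ g, 0 ≤ f g) → 0 ≤ A f)
    (hA1 : ∀ c : ℝ, A (ContinuousMap.const G c) = c) {f : C(G, ℝ)} {C : ℝ}
    (h : ∀ g, ‖f g‖ ≤ C) : ‖A f‖ ≤ C := by
  rw [Real.norm_eq_abs, abs_le]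
  constructor
  · rw [← hA1 (-C)]
    exact mono_of_nonneg hA fun g => (abs_le.1 (h g)).1
  · rw [← hA1 C]
    exact mono_of_nonneg hA fun g => (abs_le.1 (h g)).2

/-- The restriction of a function on the square of a `G`-space to the orbit of a point. -/
def orbitMap (G : Type*) {Y : Type*} [TopologicalSpace G] [TopologicalSpace Y] [SMul G Y]
    [ContinuousSMul G Y] (f : C(Y × Y, ℝ)) : C(Y × Y, C(G, ℝ)) :=
  ContinuousMap.curry ⟨fun q : (Y × Y) × G => f (q.2 • q.1.1, q.2 • q.1.2), by fun_prop⟩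

theorem orbitMap_apply {G Y : Type*} [TopologicalSpace G] [TopologicalSpace Y] [SMul G Y]
    [ContinuousSMul G Y] (f : C(Y × Y, ℝ)) (z : Y × Y) (g : G) :
    orbitMap G f z g = f (g • z.1, g • z.2) := rfl

/-- Averaging of functions on the square of a `G`-space over a compact group `G`. -/
theorem exists_averaging (G Y : Type*) [Group G] [TopologicalSpace G] [IsTopologicalGroup G]
    [CompactSpace G] [TopologicalSpace Y] [MulAction G Y] [ContinuousSMul G Y] :
    ∃ P : C(Y × Y, ℝ) →ₗ[ℝ] CInv G Y,
      (∀ f : C(Y × Y, ℝ), (∀ z, 0 ≤ f z) → ∀ z, 0 ≤ (P f).1 z) ∧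
      (∀ (f : C(Y × Y, ℝ)) (x y : Y) (c : ℝ), (∀ g : G, f (g • x, g • y) = c) →
        (P f).1 (x, y) = c) ∧
      (∀ (f : C(Y × Y, ℝ)) (C : ℝ), (∀ z, ‖f z‖ ≤ C) → ∀ z, ‖(P f).1 z‖ ≤ C) ∧
      (∀ f : C(Y × Y, ℝ), IsPseudometric f → IsPseudometric (P f).1) ∧
      (Finite G → ∃ (s : Finset G) (c : ℝ), ∀ f x y,
        (P f).1 (x, y) = c * ∑ g ∈ s, f (g • x, g • y)) := by
  obtain ⟨A, hA, hA1, hAr, hAf⟩ := exists_rightInvariant_mean G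
  have hAc : Continuous A :=
    (A.mkContinuous 1 fun f => by
      rw [one_mul]; exact norm_le_of_nonneg hA hA1 fun g => f.norm_coe_le_norm g).continuous
  refine ⟨{ toFun := fun f => ⟨⟨fun z => A (orbitMap G f z),
              hAc.comp (orbitMap G f).continuous⟩, fun h x y => ?_⟩
            map_add' := fun f f' => Subtype.ext <| ContinuousMap.ext fun z =>
              map_add A (orbitMap G f z) (orbitMap G f' z)
            map_smul' := fun c f => Subtype.ext <| ContinuousMap.ext fun z =>
              map_smul A c (orbitMap G f z) },
    fun f hf z => hA _ fun g => hf _, fun f x y c hc => ?_,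
    fun f C hC z => norm_le_of_nonneg hA hA1 fun g => hC _, fun f hf => ?_, fun hG => ?_⟩
  -- Moving the base pair by `h` translates its orbit function on the right by `h`, which is why a
  -- right-invariant mean is needed.
  · refine Eq.trans ?_ (hAr (orbitMap G f (x, y)) h)
    refine congrArg A (ContinuousMap.ext fun g => ?_)
    simp [orbitMap_apply, smul_smul]
  · refine Eq.trans (congrArg A (ContinuousMap.ext fun g => ?_)) (hA1 c)
    exact hc g
  · refine ⟨fun x y => hA _ fun g => hf.nonneg _ _, fun x => ?_, fun x y => ?_, fun x y z => ?_⟩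
    · refine Eq.trans (congrArg A (ContinuousMap.ext fun g => ?_)) (hA1 0)
      exact hf.self _
    · exact congrArg A (ContinuousMap.ext fun g => hf.symm _ _)
    · refine (mono_of_nonneg hA (f' := orbitMap G f (x, y) + orbitMap G f (y, z))
        fun g => hf.triangle _ _ _).trans_eq (map_add A _ _)
  · obtain ⟨s, c, h⟩ := hAf hG
    exact ⟨s, c, fun f x y => h _⟩

/-! ### The collapsing pseudometric and admissibility. -/

/-- The pseudometric on a metric space `Y`, truncated at `1`, obtained by collapsing `K`. -/
noncomputable def collapseDist {Y : Type*} [MetricSpace Y] (K : Set Y) (z : Y × Y) : ℝ :=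
  min 1 (min (dist z.1 z.2) (Metric.infDist z.1 K + Metric.infDist z.2 K))

section Collapse

variable {Y : Type*} [MetricSpace Y] {K : Set Y}

theorem continuous_collapseDist : Continuous (collapseDist K) :=
  continuous_const.min <| (continuous_fst.dist continuous_snd).min <|
    ((Metric.continuous_infDist_pt K).comp continuous_fst).add
      ((Metric.continuous_infDist_pt K).comp continuous_snd)

/-- In the triangle inequality, the mixed case (a direct step followed by a jump through `K`, or the
reverse) holds because `infDist · K` is 1-Lipschitz. -/
theorem isPseudometric_collapseDist : IsPseudometric (collapseDist K) where
  nonneg x y := le_min zero_le_one <| le_min dist_nonneg <|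
    add_nonneg Metric.infDist_nonneg Metric.infDist_nonneg
  self x := by
    have : 0 ≤ Metric.infDist x K + Metric.infDist x K :=
      add_nonneg Metric.infDist_nonneg Metric.infDist_nonneg
    simp [collapseDist, this]
  symm x y := by simp only [collapseDist, dist_comm, add_comm]
  triangle x y z := by
    have h1 := dist_triangle x y z
    have h2 := Metric.infDist_le_infDist_add_dist (s := K) (x := x) (y := y)
    have h3 := Metric.infDist_le_infDist_add_dist (s := K) (x := z) (y := y)
    rw [dist_comm z y] at h3
    have hx := Metric.infDist_nonneg (x := x) (s := K)
    have hy := Metric.infDist_nonneg (x := y) (s := K)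
    have hz := Metric.infDist_nonneg (x := z) (s := K)
    have hxy := dist_nonneg (x := x) (y := y)
    have hyz := dist_nonneg (x := y) (y := z)
    simp only [collapseDist]
    rcases min_cases (1 : ℝ) (min (dist x y) (Metric.infDist x K + Metric.infDist y K))
      with h | h <;>
    rcases min_cases (1 : ℝ) (min (dist y z) (Metric.infDist y K + Metric.infDist z K))
      with h' | h' <;>
    rcases min_cases (dist x y) (Metric.infDist x K + Metric.infDist y K) with h'' | h'' <;>
    rcases min_cases (dist y z) (Metric.infDist y K + Metric.infDist z K) with h''' | h''' <;>
    simp only [min_le_iff] <;>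
    first
      | (left; linarith)
      | (right; left; linarith)
      | (right; right; linarith)

theorem norm_collapseDist_le (z : Y × Y) : ‖collapseDist K z‖ ≤ 1 := by
  rw [Real.norm_of_nonneg (isPseudometric_collapseDist.nonneg z.1 z.2)]
  exact min_le_left _ _

theorem collapseDist_of_mem {x y : Y} (hx : x ∈ K) (hy : y ∈ K) : collapseDist K (x, y) = 0 := by
  simp [collapseDist, Metric.infDist_zero_of_mem hx, Metric.infDist_zero_of_mem hy]

theorem collapseDist_smul {G : Type*} [Group G] [MulAction G Y] [IsIsometricSMul G Y]
    (hK : ∀ (g : G), ∀ x ∈ K, g • x ∈ K) (g : G) (x y : Y) :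
    collapseDist K (g • x, g • y) = collapseDist K (x, y) := by
  have himg : (fun x => g • x) '' K = K := by
    refine Subset.antisymm (image_subset_iff.2 (hK g)) fun x hx => ?_
    exact ⟨g⁻¹ • x, hK _ _ hx, smul_inv_smul g x⟩
  have h : ∀ x : Y, Metric.infDist (g • x) K = Metric.infDist x K := fun x => by
    conv_lhs => rw [← himg]
    exact Metric.infDist_image (isometry_smul Y g)
  simp [collapseDist, h]

theorem collapseDist_pos (hK : IsClosed K) {x y : Y} (hx : x ∉ K) (hxy : x ≠ y)
    (hne : K.Nonempty) : 0 < collapseDist K (x, y) :=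
  lt_min one_pos <| lt_min (dist_pos.2 hxy) <|
    add_pos_of_pos_of_nonneg ((hK.notMem_iff_infDist_pos hne).1 hx) Metric.infDist_nonneg

/-- A continuous pseudometric dominating a multiple of `collapseDist K`, for a compact set `K`, is
an admissible metric as soon as it separates the points of `K`. -/
theorem isAdmissibleMetric_of_collapseDist_le (hK : IsCompact K) (hne : K.Nonempty)
    {q : Y × Y → ℝ} (hq : IsPseudometric q) (hqc : Continuous q) {c : ℝ} (hc : 0 < c)
    (hle : ∀ z, c * collapseDist K z ≤ q z)
    (hsep : ∀ x ∈ K, ∀ y ∈ K, q (x, y) = 0 → x = y) : IsAdmissibleMetric q := by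
  have heq : ∀ x y, q (x, y) = 0 → x = y := by
    intro x y h
    by_contra hxy
    have hfalse : ∀ x y, q (x, y) = 0 → x ≠ y → x ∈ K := fun x y h hxy => by
      by_contra hx
      have := mul_pos hc (collapseDist_pos hK.isClosed hx hxy hne)
      linarith [hle (x, y)]
    exact hxy (hsep x (hfalse x y h hxy) y
      (hfalse y x (by rw [hq.symm, h]) (Ne.symm hxy)) h)
  refine ⟨⟨hq, heq⟩, hqc, fun x U hU hx => ?_⟩
  by_cases hxK : x ∈ K
  · have hqx : Continuous fun y => q (x, y) := hqc.comp (Continuous.prodMk_right x)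
    -- By compactness `q (x, ·)` is bounded away from `0` on `K \ U`; halving the minimum makes the
    -- bound strict, so `U ∪ {r < q (x, ·)}` is an open neighborhood of `K` and contains a
    -- thickening of it.
    obtain ⟨r, hr, hrK⟩ : ∃ r > 0, ∀ y ∈ K \ U, r < q (x, y) := by
      rcases (K \ U).eq_empty_or_nonempty with he | hn
      · exact ⟨1, one_pos, by simp [he]⟩
      · obtain ⟨y₀, hy₀, hmin⟩ := (hK.diff hU).exists_isMinOn hn hqx.continuousOn
        have hpos : 0 < q (x, y₀) := lt_of_le_of_ne (hq.nonneg _ _) fun h =>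
          hy₀.2 (heq x y₀ h.symm ▸ hx)
        exact ⟨q (x, y₀) / 2, by linarith, fun y hy => by linarith [isMinOn_iff.1 hmin y hy]⟩
    have hO : IsOpen (U ∪ {y | r < q (x, y)}) := hU.union (isOpen_lt continuous_const hqx)
    obtain ⟨δ, hδ, hsub⟩ := hK.exists_thickening_subset_open hO fun y hy => by
      by_cases hyU : y ∈ U
      · exact Or.inl hyU
      · exact Or.inr (hrK y ⟨hy, hyU⟩)
    -- The second bound forces `y` into the `δ`-thickening of `K`; the first excludes `r < q (x,
    -- y)`, leaving `y ∈ U`.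
    refine ⟨min r (c * min 1 δ), lt_min hr (mul_pos hc (lt_min one_pos hδ)), fun y hy => ?_⟩
    have hy' : q (x, y) < min r (c * min 1 δ) := hy
    have h1 : collapseDist K (x, y) < min 1 δ :=
      lt_of_mul_lt_mul_left ((hle _).trans_lt (hy'.trans_le (min_le_right _ _))) hc.le
    have h2 : Metric.infDist y K < δ := by
      have h3 := Metric.infDist_le_dist_of_mem (x := y) hxK
      rw [dist_comm] at h3
      simp only [collapseDist, Metric.infDist_zero_of_mem hxK, zero_add, min_eq_right h3] at h1
      rcases min_lt_iff.1 h1 with h | h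
      · exact absurd h (min_le_left _ _).not_gt
      · exact h.trans_le (min_le_right _ _)
    rcases hsub ((Metric.mem_thickening_iff_infDist_lt hne).2 h2) with h | h
    · exact h
    · exact absurd (hy'.trans_le (min_le_left _ _)) (not_lt.2 (le_of_lt h))
  · obtain ⟨δ, hδ, hsub⟩ := Metric.isOpen_iff.1 hU x hx
    have hpos := (hK.isClosed.notMem_iff_infDist_pos hne).1 hxK
    refine ⟨c * min 1 (min δ (Metric.infDist x K)),
      mul_pos hc (lt_min one_pos (lt_min hδ hpos)), fun y hy => hsub ?_⟩
    have h1 : collapseDist K (x, y) < min 1 (min δ (Metric.infDist x K)) :=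
      lt_of_mul_lt_mul_left ((hle _).trans_lt hy) hc.le
    have hy0 := Metric.infDist_nonneg (x := y) (s := K)
    rw [Metric.mem_ball']
    by_contra! hd
    refine h1.not_ge (min_le_min le_rfl (min_le_min hd ?_))
    exact le_add_of_nonneg_right hy0

end Collapse

/-! ### Norm bounds, continuity and the assembly of the operator. -/

/-- A linear operator which is bounded for the sup-norms is continuous, if `X` is compact. -/
theorem continuous_of_norm_le {G X Y : Type*} [TopologicalSpace X] [CompactSpace X] [SMul G X]
    [TopologicalSpace Y] [SMul G Y] (T : CInv G X →ₗ[ℝ] CInv G Y) (C : ℝ)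
    (hT : ∀ p z, ‖(T p).1 z‖ ≤ C * ‖p.1‖) : Continuous T := by
  refine continuous_induced_rng.2 (continuous_iff_continuousAt.2 fun p => ?_)
  refine ContinuousMap.tendsto_of_tendstoLocallyUniformly
    (TendstoUniformly.tendstoLocallyUniformly ?_)
  rw [Metric.tendstoUniformly_iff]
  intro δ hδ
  have hlim : Tendsto (fun q : CInv G X => C * ‖(q - p).1‖) (𝓝 p) (𝓝 0) := by
    have hc : Continuous fun q : CInv G X => C * ‖(q - p).1‖ := by fun_prop
    simpa using hc.tendsto p
  filter_upwards [hlim.eventually_lt_const hδ] with q hq z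
  refine lt_of_le_of_lt ?_ hq
  rw [dist_comm, dist_eq_norm]
  simpa using hT (q - p) z

theorem opNorm_le_of_norm_le {G X Y : Type*} [TopologicalSpace X] [CompactSpace X] [SMul G X]
    [TopologicalSpace Y] [SMul G Y] (T : CInv G X →ₗ[ℝ] CInv G Y) (C : ℝ≥0)
    (hT : ∀ p z, ‖(T p).1 z‖ ≤ C * ‖p.1‖) : opNorm T ≤ C := by
  refine iInf₂_le C fun p => iSup_le fun z => ?_
  -- Compactness of `X` makes `supNorm` finite, so it can be compared with the norm of `C(X × X,
  -- ℝ)`.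
  have hp : ‖p.1‖ₑ ≤ supNorm p.1 := by
    rw [← ofReal_norm]
    refine ENNReal.ofReal_le_of_le_toReal ?_
    have hfin : supNorm p.1 ≠ ∞ := by
      refine ne_top_of_le_ne_top (enorm_ne_top (x := p.1)) (iSup_le fun z => ?_)
      rw [enorm_le_iff_norm_le]
      exact p.1.norm_coe_le_norm z
    refine (ContinuousMap.norm_le _ ENNReal.toReal_nonneg).2 fun z => ?_
    rw [← toReal_enorm]
    exact ENNReal.toReal_mono hfin (le_iSup (fun z => ‖p.1 z‖ₑ) z)
  calc ‖(T p).1 z‖ₑ = ENNReal.ofReal ‖(T p).1 z‖ := (ofReal_norm _).symm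
    _ ≤ ENNReal.ofReal (C * ‖p.1‖) := ENNReal.ofReal_le_ofReal (hT p z)
    _ = C * ‖p.1‖ₑ := by
      rw [ENNReal.ofReal_mul C.coe_nonneg, ENNReal.ofReal_coe_nnreal, ofReal_norm]
    _ ≤ C * supNorm p.1 := by gcongr

theorem continuous_pointwise_eval {G X : Type*} [TopologicalSpace X] [SMul G X] (v : X × X) :
    Continuous[pointwiseTopology G X, inferInstance] fun p : CInv G X => p.1 v :=
  @Continuous.comp _ _ _ (pointwiseTopology G X) _ _ _ _ (continuous_apply v) continuous_induced_dom

/-- The extension theorem for an isometric action. -/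
theorem exists_invariant_extension {G : Type*} [Group G] [TopologicalSpace G]
    [IsTopologicalGroup G] [CompactSpace G] {Y : Type*} [MetricSpace Y]
    [MulAction G Y] [ContinuousSMul G Y] [IsIsometricSMul G Y]
    (X : SubMulAction G Y) [CompactSpace X] (hXn : (X : Set Y).Nontrivial)
    (ε : ℝ) (hε : 0 < ε) :
    ∃ T : CInv G X →ₗ[ℝ] CInv G Y,
      (∀ p : CInv G X, (∀ z, 0 ≤ p.1 z) → ∀ z, 0 ≤ (T p).1 z) ∧
      (∀ (p : CInv G X) (x x' : X), (T p).1 ((x : Y), (x' : Y)) = p.1 (x, x')) ∧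
      (∀ p z, ‖(T p).1 z‖ ≤ (1 + ε) * ‖p.1‖) ∧
      (∀ p : CInv G X, IsPseudometric p.1 → IsPseudometric (T p).1) ∧
      (∀ p : CInv G X, IsMetric p.1 → IsAdmissibleMetric (T p).1) ∧
      (Finite G → Continuous[pointwiseTopology G X, pointwiseTopology G Y] T) := by
  obtain ⟨a, ha, b, hb, hab⟩ := hXn
  have hXc : IsCompact (X : Set Y) := isCompact_iff_compactSpace.2 ‹_›
  have : Nonempty X := ⟨⟨a, ha⟩⟩
  obtain ⟨S, hS0, hSext, hSn, hSp, hSf⟩ :=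
    exists_linear_extension (ι := ((↑) : X → Y)) isometry_subtype_coe
  obtain ⟨P, hP0, hPc, hPn, hPp, hPf⟩ := exists_averaging G Y
  let K : Set Y := X
  let e : X × X := (⟨a, ha⟩, ⟨b, hb⟩)
  let d : CInv G Y := ⟨⟨collapseDist K, continuous_collapseDist⟩,
    fun g x y => collapseDist_smul (fun g x hx => X.smul_mem g hx) g x y⟩
  have hd0 : ∀ z, 0 ≤ collapseDist K z := fun z => isPseudometric_collapseDist.nonneg z.1 z.2
  let T : CInv G X →ₗ[ℝ] CInv G Y :=
    { toFun := fun p => P (S p.1) + (ε * p.1 e) • d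
      map_add' := fun p q => by
        simp only [Submodule.coe_add, map_add, ContinuousMap.add_apply, mul_add, add_smul]
        abel
      map_smul' := fun c p => by
        simp only [Submodule.coe_smul, map_smul, ContinuousMap.smul_apply, smul_eq_mul,
          RingHom.id_apply, smul_add, smul_smul]
        rw [mul_left_comm] }
  have hT : ∀ p z, (T p).1 z = (P (S p.1)).1 z + ε * p.1 e * collapseDist K z := fun p z => rfl
  have hext : ∀ (p : CInv G X) (x x' : X), (T p).1 ((x : Y), (x' : Y)) = p.1 (x, x') := by
    intro p x x'
    rw [hT, collapseDist_of_mem x.2 x'.2, mul_zero, add_zero]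
    refine hPc _ _ _ _ fun g => ?_
    exact (hSext p.1 (g • x) (g • x')).trans (p.2 g x x')
  have hps : ∀ p : CInv G X, IsPseudometric p.1 → IsPseudometric (T p).1 := fun p hp => by
    have h1 := hPp _ (hSp _ hp)
    have h2 : IsPseudometric (collapseDist K) := isPseudometric_collapseDist
    have hc : 0 ≤ ε * p.1 e := mul_nonneg hε.le (hp.nonneg _ _)
    refine ⟨fun x y => ?_, fun x => ?_, fun x y => ?_, fun x y z => ?_⟩
    · rw [hT]
      exact add_nonneg (h1.nonneg _ _) (mul_nonneg hc (h2.nonneg _ _))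
    · rw [hT, h1.self, h2.self, mul_zero, add_zero]
    · rw [hT, hT, h1.symm, h2.symm]
    · rw [hT, hT, hT]
      have := mul_le_mul_of_nonneg_left (h2.triangle x y z) hc
      linarith [h1.triangle x y z]
  refine ⟨T, fun p hp z => ?_, hext, fun p z => ?_, hps, fun p hp => ?_, fun hG => ?_⟩
  · rw [hT]
    exact add_nonneg (hP0 _ (hS0 _ hp) z) (mul_nonneg (mul_nonneg hε.le (hp e)) (hd0 z))
  · rw [hT]
    calc _ ≤ ‖(P (S p.1)).1 z‖ + ‖ε * p.1 e * collapseDist K z‖ := norm_add_le _ _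
      _ ≤ ‖p.1‖ + ε * ‖p.1‖ * 1 := by
        refine add_le_add (hPn _ _ (hSn p.1) z) ?_
        rw [norm_mul, norm_mul, Real.norm_of_nonneg hε.le]
        gcongr
        · exact p.1.norm_coe_le_norm e
        · exact norm_collapseDist_le z
      _ = (1 + ε) * ‖p.1‖ := by ring
  · have hpos : 0 < p.1 e := lt_of_le_of_ne (hp.nonneg _ _) fun h =>
      hab (congrArg Subtype.val (hp.eq_of_eq_zero _ _ h.symm))
    refine isAdmissibleMetric_of_collapseDist_le hXc ⟨a, ha⟩ (hps p hp.toIsPseudometric)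
      (T p).1.continuous (mul_pos hε hpos) (fun z => ?_) fun x hx y hy h => ?_
    · rw [hT]
      exact le_add_of_nonneg_left ((hPp _ (hSp _ hp.toIsPseudometric)).nonneg z.1 z.2)
    · exact congrArg Subtype.val
        (hp.eq_of_eq_zero ⟨x, hx⟩ ⟨y, hy⟩ ((hext p ⟨x, hx⟩ ⟨y, hy⟩).symm.trans h))
  -- For finite `G`, each value of `T p` is a fixed finite linear combination of values of `p`.
  · let := pointwiseTopology G X
    obtain ⟨s, c, hsc⟩ := hPf hG
    refine continuous_induced_rng.2 (continuous_pi fun z => ?_)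
    have hev : ∀ v : X × X, Continuous fun p : CInv G X => p.1 v := continuous_pointwise_eval
    have hS : ∀ z, Continuous fun p : CInv G X => S p.1 z := fun z => by
      obtain ⟨t, w, h⟩ := hSf z
      simp_rw [h]
      exact continuous_finsetSum _ fun v _ => continuous_const.mul (hev v)
    have : ∀ p : CInv G X, (T p).1 z =
        c * ∑ g ∈ s, S p.1 (g • z.1, g • z.2) + ε * p.1 e * collapseDist K z := fun p => by
      rw [hT, ← hsc]
    simp only [Function.comp_apply, this]
    exact (continuous_const.mul (continuous_finsetSum _ fun g _ => hS _)).add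
      ((continuous_const.mul (hev e)).mul continuous_const)

end InvMetric

theorem theorem4p2 {G : Type*} [Group G] [TopologicalSpace G] [IsTopologicalGroup G]
    [CompactSpace G] {Y : Type*} [TopologicalSpace Y] [TopologicalSpace.MetrizableSpace Y]
    [MulAction G Y] [ContinuousSMul G Y]
    (X : SubMulAction G Y) (hXc : IsCompact (X : Set Y)) (hXn : (X : Set Y).Nontrivial)
    (ε : ℝ) (hε : 0 < ε) :
    ∃ T : InvMetric.CInv G X →ₗ[ℝ] InvMetric.CInv G Y,
      -- positive
      (∀ p : InvMetric.CInv G X, (∀ z, 0 ≤ p.1 z) → ∀ z, 0 ≤ (T p).1 z) ∧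
      -- continuous for the compact-open topologies
      Continuous T ∧
      -- extension operator
      (∀ (p : InvMetric.CInv G X) (x x' : X), (T p).1 ((x : Y), (x' : Y)) = p.1 (x, x')) ∧
      -- norm bound
      InvMetric.opNorm T < ENNReal.ofReal (1 + ε) ∧
      -- preservation of continuous invariant pseudometrics, of continuous invariant metrics
      -- and of admissible invariant metrics
      (∀ p : InvMetric.CInv G X,
        InvMetric.IsPseudometric p.1 → InvMetric.IsPseudometric (T p).1) ∧
      (∀ p : InvMetric.CInv G X, InvMetric.IsMetric p.1 → InvMetric.IsMetric (T p).1) ∧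
      (∀ p : InvMetric.CInv G X,
        InvMetric.IsAdmissibleMetric p.1 → InvMetric.IsAdmissibleMetric (T p).1) ∧
      -- pointwise continuity for finite groups
      (Finite G →
        Continuous[InvMetric.pointwiseTopology G X, InvMetric.pointwiseTopology G Y] T) := by
  -- The given topology of `Y` is replaced by that of an invariant metric.
  obtain ⟨m, rfl, hm⟩ := InvMetric.exists_metricSpace_isIsometricSMul G Y
  have : CompactSpace X := isCompact_iff_compactSpace.1 hXc
  -- Half of `ε` is used so that the final norm bound is strict.
  obtain ⟨T, hT0, hText, hTn, hTp, hTm, hTf⟩ :=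
    InvMetric.exists_invariant_extension X hXn (ε / 2) (half_pos hε)
  refine ⟨T, hT0, InvMetric.continuous_of_norm_le T _ hTn, hText, ?_, hTp,
    fun p hp => (hTm p hp).toIsMetric, fun p hp => hTm p hp.toIsMetric, hTf⟩
  have hC : 0 ≤ 1 + ε / 2 := by linarith
  refine (InvMetric.opNorm_le_of_norm_le T (NNReal.mk (1 + ε / 2) hC) hTn).trans_lt ?_
  rw [← ENNReal.ofReal_eq_coe_nnreal hC]
  exact (ENNReal.ofReal_lt_ofReal_iff (by linarith)).2 (by linarith)
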